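/- A graph consists of a vertex set $V$, an edge set $E$, maps $\alpha,\omega:E\to V$ (source and destination) and an involution $e\mapsto\overline e$ of $E$ with $\alpha(\overline e)=\omega(e)$; loops, multiple edges and edges with $\overline e=e$ are allowed. It is locally finite if every vertex is the source of finitely many edges, and connected if any two vertices are joined by a path. A path of length $n\ge 0$ from $x$ to $y$ is a sequence of vertices and edges $(v_0,e_1,v_1,\dots,e_n,v_n)$ with $v_0=x$, $v_n=y$, $\alpha(e_i)=v_{i-1}$ and $\omega(e_i)=v_i$. The circuit series of a locally finite graph $\mathcal G$ with base point $*$ is $G(t)=\sum_{n\ge0}g_nt^n$, where $g_n$ is the number of paths of length $n$ from $*$ to $*$. A power series $f(t)$ is algebraic if $P(t,f(t))=0$ for some nonzero polynomial $P\in\mathbb Q[t,y]$. The free product $\mathcal E*\mathcal F$ of two connected pointed graphs $(\mathcal E,*)$ and $(\mathcal F,*)$ is constructed as follows: start with copies of $\mathcal E$ and $\mathcal F$ identified at $*$; at each vertex $v\neq *$ of $\mathcal E$, respectively $\mathcal F$, glue a copy of $\mathcal F$, respectively $\mathcal E$, by identifying $v$ with the base point of the copy; repeat the process indefinitely, gluing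 copies of $\mathcal E$ and $\mathcal F$ at the new vertices. It is pointed by the vertex $*$ from the first step. Let $(\mathcal E,*)$ and $(\mathcal F,*)$ be connected, locally finite pointed graphs. If the circuit series of $(\mathcal E,*)$ and of $(\mathcal F,*)$ are both algebraic, then the circuit series of $(\mathcal E*\mathcal F,*)$ is algebraic. -/

import Mathlib

universe u v u' v'

/-- A graph, possibly with loops and multiple edges: every edge `e` is oriented, with source
`src e` and destination `dst e`, and comes with an inverse edge `rev e` (possibly `e` itself,
in which case `e` is a loop). -/
structure InvGraph (V : Type u) (E : Type v) where
  src : E → V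
  dst : E → V
  rev : E → E
  rev_rev : ∀ e, rev (rev e) = e
  src_rev : ∀ e, src (rev e) = dst e

namespace InvGraph

variable {V : Type u} {E : Type v} {W : Type u'} {F : Type v'}

/-- Every vertex has finite degree. -/
def LocallyFinite (G : InvGraph V E) : Prop :=
  ∀ x, {e | G.src e = x}.Finite

/-- `G.IsPath x l y`: the edges in the list `l` are, in this order, the edges of a path
from `x` to `y`. Once the start `x` is given, the path is determined by its edges. -/
def IsPath (G : InvGraph V E) : V → List E → V → Prop
  | x, [], y => x = y
  | x, e :: l, y => G.src e = x ∧ G.IsPath (G.dst e) l y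

/-- Any two vertices are joined by a path. -/
def Connected (G : InvGraph V E) : Prop :=
  ∀ x y, ∃ l, G.IsPath x l y

/-- The set of paths of length `n` from `x` to `y`. -/
def pathsOfLength (G : InvGraph V E) (x y : V) (n : ℕ) : Set (List E) :=
  {l | G.IsPath x l y ∧ l.length = n}

/-- In a locally finite graph there are finitely many paths of given length and endpoints. -/
theorem LocallyFinite.finite_pathsOfLength {G : InvGraph V E} (hG : G.LocallyFinite)
    (x y : V) (n : ℕ) : (G.pathsOfLength x y n).Finite := by
  induction n generalizing x with
  | zero =>
    refine (Set.finite_singleton ([] : List E)).subset ?_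
    rintro l ⟨-, hl⟩
    exact List.length_eq_zero_iff.mp hl
  | succ n ih =>
    refine ((hG x).biUnion fun e _ => (ih (G.dst e)).image (List.cons e)).subset ?_
    rintro l ⟨hp, hl⟩
    cases l with
    | nil => simp at hl
    | cons e l =>
      refine Set.mem_biUnion (x := e) hp.1 ⟨l, ⟨hp.2, ?_⟩, rfl⟩
      simpa using hl

/-- The path series `∑ t ^ |π|` over all paths `π` from `x` to `y` (for `G` locally finite). -/
noncomputable def pathSeries (G : InvGraph V E) (x y : V) : PowerSeries ℕ :=
  PowerSeries.mk fun n => (G.pathsOfLength x y n).ncard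

/-- The circuit series of the pointed graph `(G, x)`. -/
noncomputable def circuitSeries (G : InvGraph V E) (x : V) : PowerSeries ℕ :=
  G.pathSeries x x

/-! ### Free products of pointed graphs

A vertex of the free product of `(A, a)` and `(B, b)` is a word whose letters are vertices of `A`
other than `a` and vertices of `B` other than `b`, in alternation. The head of the list is the
letter added last: if `w` does not start with a letter from `A`, a copy of `A` is glued at `w`;
its vertex `a` is `w` itself and its vertex `v ≠ a` is `v :: w`. Likewise for `B`. Both a copy of
`A` and a copy of `B` are glued at the empty word. -/

/-- Letters: vertices of either graph apart from the base points. -/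
abbrev Letter (a : V) (b : W) : Type (max u u') :=
  {v : V // v ≠ a} ⊕ {v : W // v ≠ b}

/-- Vertices of the free product: words with alternating letters. -/
def FPVertex (a : V) (b : W) : Type (max u u') :=
  {w : List (Letter a b) // w.IsChain fun x y => x.isLeft ≠ y.isLeft}

/-- The vertex at which the copies of `A` and `B` from the first step are identified. -/
def FPVertex.base (a : V) (b : W) : FPVertex a b :=
  ⟨[], List.isChain_nil⟩

/-- The vertices at which a copy of the first graph is glued by its base point. -/
def FPRootL (a : V) (b : W) : Type (max u u') :=
  {w : FPVertex a b // ∀ x ∈ w.1.head?, x.isRight}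

/-- The vertices at which a copy of the second graph is glued by its base point. -/
def FPRootR (a : V) (b : W) : Type (max u u') :=
  {w : FPVertex a b // ∀ x ∈ w.1.head?, x.isLeft}

open Classical in
/-- The vertex `v` of the copy of the first graph glued at `w`. -/
noncomputable def FPRootL.vertex {a : V} {b : W} (w : FPRootL a b) (v : V) : FPVertex a b :=
  if h : v = a then w.1
  else ⟨Sum.inl ⟨v, h⟩ :: w.1.1, List.isChain_cons.mpr ⟨fun y hy => by
    have := w.2 y hy
    cases y <;> simp_all, w.1.2⟩⟩

open Classical in
/-- The vertex `v` of the copy of the second graph glued at `w`. -/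
noncomputable def FPRootR.vertex {a : V} {b : W} (w : FPRootR a b) (v : W) : FPVertex a b :=
  if h : v = b then w.1
  else ⟨Sum.inr ⟨v, h⟩ :: w.1.1, List.isChain_cons.mpr ⟨fun y hy => by
    have := w.2 y hy
    cases y <;> simp_all, w.1.2⟩⟩

theorem FPRootL.vertex_base {a : V} {b : W} (w : FPRootL a b) : w.vertex a = w.1 :=
  dif_pos rfl

theorem FPRootL.val_vertex_of_ne {a : V} {b : W} (w : FPRootL a b) {v : V} (h : v ≠ a) :
    (w.vertex v).1 = Sum.inl ⟨v, h⟩ :: w.1.1 :=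
  congrArg Subtype.val (dif_neg h)

theorem FPRootR.vertex_base {a : V} {b : W} (w : FPRootR a b) : w.vertex b = w.1 :=
  dif_pos rfl

theorem FPRootR.val_vertex_of_ne {a : V} {b : W} (w : FPRootR a b) {v : W} (h : v ≠ b) :
    (w.vertex v).1 = Sum.inr ⟨v, h⟩ :: w.1.1 :=
  congrArg Subtype.val (dif_neg h)

/-- The free product of the pointed graphs `(A, a)` and `(B, b)`: its edges are the edges of all
the glued copies of `A` and of `B`. It is pointed by `FPVertex.base a b`. -/
noncomputable def freeProduct (A : InvGraph V E) (a : V) (B : InvGraph W F) (b : W) :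
    InvGraph (FPVertex a b) ((FPRootL a b × E) ⊕ (FPRootR a b × F)) where
  src := Sum.elim (fun p => p.1.vertex (A.src p.2)) (fun p => p.1.vertex (B.src p.2))
  dst := Sum.elim (fun p => p.1.vertex (A.dst p.2)) (fun p => p.1.vertex (B.dst p.2))
  rev := Sum.map (fun p => (p.1, A.rev p.2)) (fun p => (p.1, B.rev p.2))
  rev_rev := by rintro (⟨w, e⟩ | ⟨w, e⟩) <;> simp [A.rev_rev, B.rev_rev]
  src_rev := by rintro (⟨w, e⟩ | ⟨w, e⟩) <;> simp [A.src_rev, B.src_rev]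

/-- A vertex of the free product lies in finitely many copies of the first graph. -/
theorem FPRootL.finite_vertex_eq {a : V} {b : W} (x : FPVertex a b) :
    {p : FPRootL a b × V | p.1.vertex p.2 = x}.Finite := by
  have h1 : {p : FPRootL a b × V | p.1.vertex p.2 = x ∧ p.2 = a}.Subsingleton := by
    rintro ⟨w, v⟩ ⟨h, hv⟩ ⟨w', v'⟩ ⟨h', hv'⟩
    simp only at hv hv'
    subst hv hv'
    simp only [FPRootL.vertex_base] at h h'
    rw [Subtype.ext (h.trans h'.symm)]
  have h2 : {p : FPRootL a b × V | p.1.vertex p.2 = x ∧ p.2 ≠ a}.Subsingleton := by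
    rintro ⟨w, v⟩ ⟨h, hv⟩ ⟨w', v'⟩ ⟨h', hv'⟩
    simp only [ne_eq] at hv hv'
    have := congrArg Subtype.val (h.trans h'.symm)
    simp only [w.val_vertex_of_ne hv, w'.val_vertex_of_ne hv', List.cons.injEq, Sum.inl.injEq, Subtype.mk.injEq] at this
    exact Prod.ext (Subtype.ext (Subtype.ext this.2)) this.1
  refine (h1.finite.union h2.finite).subset fun p hp => ?_
  by_cases hpa : p.2 = a
  exacts [Or.inl ⟨hp, hpa⟩, Or.inr ⟨hp, hpa⟩]

/-- A vertex of the free product lies in finitely many copies of the second graph. -/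
theorem FPRootR.finite_vertex_eq {a : V} {b : W} (x : FPVertex a b) :
    {p : FPRootR a b × W | p.1.vertex p.2 = x}.Finite := by
  have h1 : {p : FPRootR a b × W | p.1.vertex p.2 = x ∧ p.2 = b}.Subsingleton := by
    rintro ⟨w, v⟩ ⟨h, hv⟩ ⟨w', v'⟩ ⟨h', hv'⟩
    simp only at hv hv'
    subst hv hv'
    simp only [FPRootR.vertex_base] at h h'
    rw [Subtype.ext (h.trans h'.symm)]
  have h2 : {p : FPRootR a b × W | p.1.vertex p.2 = x ∧ p.2 ≠ b}.Subsingleton := by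
    rintro ⟨w, v⟩ ⟨h, hv⟩ ⟨w', v'⟩ ⟨h', hv'⟩
    simp only [ne_eq] at hv hv'
    have := congrArg Subtype.val (h.trans h'.symm)
    simp only [w.val_vertex_of_ne hv, w'.val_vertex_of_ne hv', List.cons.injEq, Sum.inr.injEq, Subtype.mk.injEq] at this
    exact Prod.ext (Subtype.ext (Subtype.ext this.2)) this.1
  refine (h1.finite.union h2.finite).subset fun p hp => ?_
  by_cases hpb : p.2 = b
  exacts [Or.inl ⟨hp, hpb⟩, Or.inr ⟨hp, hpb⟩]

/-- The free product of locally finite graphs is locally finite, so that its circuit series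
counts finite sets of circuits. -/
theorem LocallyFinite.freeProduct {A : InvGraph V E} {B : InvGraph W F}
    (hA : A.LocallyFinite) (hB : B.LocallyFinite) (a : V) (b : W) :
    (A.freeProduct a B b).LocallyFinite := by
  intro x
  refine ((((FPRootL.finite_vertex_eq x).biUnion fun p _ =>
      (hA p.2).image fun e => (Sum.inl (p.1, e) : (FPRootL a b × E) ⊕ (FPRootR a b × F)))).union
    ((FPRootR.finite_vertex_eq x).biUnion fun p _ =>
      (hB p.2).image fun e => (Sum.inr (p.1, e) : (FPRootL a b × E) ⊕ (FPRootR a b × F)))).subset ?_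
  rintro (⟨w, e⟩ | ⟨w, e⟩) h
  · exact Or.inl (Set.mem_biUnion (x := (w, A.src e)) h ⟨e, rfl, rfl⟩)
  · exact Or.inr (Set.mem_biUnion (x := (w, B.src e)) h ⟨e, rfl, rfl⟩)

end InvGraph

/-- A power series `f(t)` with natural coefficients is algebraic if `P(t, f(t)) = 0` for some
nonzero polynomial `P(t, y)` with rational coefficients. -/
def IsAlgebraicSeries (f : PowerSeries ℕ) : Prop :=
  IsAlgebraic (Polynomial ℚ) (PowerSeries.map (Nat.castRingHom ℚ) f)

/-! Let `e`, `f`, `g` be the circuit series of `A`, `B` and the free product, and let `α`, `β` count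
first returns to the base whose first edge lies in its copy of `A`, respectively `B`. Cutting
circuits at the base gives `g = 1 / (1 - α - β)`. A circuit is also a circuit of `A` with arbitrary
excursions through copies of `B` inserted at each visited vertex, so with `s = X / (1 - β)` one has
`g * (1 - β) = e(s)`; likewise `g * (1 - α) = f(r)` for `r = X / (1 - α)`.

Algebraicity is then a transcendence degree count. Put `z = X * g`. Since `z = s * e(s) = r * f(r)`,
both `s` and `r` are algebraic over `K(z)`, and `1/X = 1/s + 1/r - 1/z` makes `X` algebraic over
`K(z)`. By exchange `z`, hence `g`, is algebraic over `K(X)` (`isAlgebraic_of_subst_relations`).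

First returns are never counted: `α` and `β` come from an `X`-adic fixed point
(`exists_branchReturn_eq`), and `g` is identified by guessing the solution of the linear system that
characterizes path series (`circuitSeries_freeProduct`). -/

open PowerSeries

/-! ### Algebraic dependence of power series -/

section

open Algebra

/-- Exchange property of algebraic dependence for two elements. -/
theorem IsAlgebraic.adjoin_singleton_symm {R A : Type*} [CommRing R] [CommRing A] [Algebra R A]
    {x y : A} (h : IsAlgebraic (adjoin R {x}) y) (hy : Transcendental R y) :
    IsAlgebraic (adjoin R {y}) x := by
  by_contra hx
  have hne : x ≠ y := by
    rintro rfl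
    exact hx h
  have hind : AlgebraicIndepOn R (id : A → A) {y} := by
    rw [AlgebraicIndepOn, algebraicIndependent_unique_type_iff]
    exact hy
  have hins : AlgebraicIndepOn R (id : A → A) (insert x {y}) :=
    hind.insert (by rwa [Set.image_id])
  have := hins.transcendental_adjoin (s := {⟨x, by simp⟩}) (i := ⟨y, by simp⟩)
    (by simpa [Subtype.ext_iff] using hne.symm)
  rw [Set.image_singleton] at this
  exact this h

namespace PowerSeries

/-- A nonzero power series without constant term is transcendental over the coefficients. -/
theorem transcendental_of_constantCoeff_eq_zero {K : Type*} [Field K] {f : K⟦X⟧} (hf : f ≠ 0)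
    (h0 : constantCoeff f = 0) : Transcendental K f := by
  rintro ⟨p, hp, hpf⟩
  -- Once the power of `f` is cancelled, the constant term of `q(f)` is `q(0)`, which is nonzero.
  obtain ⟨q, hq, hq0⟩ := Polynomial.exists_eq_pow_rootMultiplicity_mul_and_not_dvd p hp 0
  rw [map_zero, sub_zero] at hq hq0
  rw [hq, map_mul, map_pow, Polynomial.aeval_X] at hpf
  have hqf := (mul_eq_zero.mp hpf).resolve_left (pow_ne_zero _ hf)
  refine hq0 (Polynomial.X_dvd_iff.mpr ?_)
  have := congrArg constantCoeff hqf
  rw [Polynomial.aeval_def, Polynomial.hom_eval₂, h0, Polynomial.eval₂_at_zero] at this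
  simpa [algebraMap_apply] using this

/-- Substitution maps `K[X]` to `K[s]`, injectively because `s` is transcendental, so an equation
for `f` over `K[X]` becomes a nontrivial one over `K[s]`. -/
theorem isAlgebraic_adjoin_subst {K : Type*} [Field K] {f s : K⟦X⟧}
    (hf : IsAlgebraic (Polynomial K) f) (hs : s ≠ 0) (h0 : constantCoeff s = 0) :
    IsAlgebraic (adjoin K {s}) (f.subst s) := by
  have hsub : HasSubst s := .of_constantCoeff_zero' h0
  have htr := transcendental_of_constantCoeff_eq_zero hs h0
  rw [← coe_substAlgHom hsub]
  refine hf.ringHom_of_comp_eq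
    (Polynomial.aeval (⟨s, subset_adjoin rfl⟩ : adjoin K {s})) (substAlgHom hsub) ?_ ?_
  · refine transcendental_iff_injective.mp fun h => htr ?_
    exact h.algebraMap
  · refine RingHom.ext fun p => ?_
    change ((Polynomial.aeval (⟨s, subset_adjoin rfl⟩ : adjoin K {s}) p : adjoin K {s}) : K⟦X⟧) =
      substAlgHom hsub ((p : K⟦X⟧).map (algebraMap K K))
    rw [algebraMap_self, map_id, id_eq, substAlgHom_coe]
    exact Polynomial.aeval_subalgebra_coe p _ _

theorem isAlgebraic_of_adjoin_X {K : Type*} [Field K] {f : K⟦X⟧}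
    (hf : IsAlgebraic (adjoin K {(X : K⟦X⟧)}) f) : IsAlgebraic (Polynomial K) f := by
  refine IsAlgebraic.of_ringHom_of_comp_eq
    (Polynomial.aeval (⟨X, subset_adjoin rfl⟩ : adjoin K {(X : K⟦X⟧)})) (RingHom.id K⟦X⟧)
    hf ?_ Function.injective_id ?_
  · rintro ⟨x, hx⟩
    rw [adjoin_singleton_eq_range_aeval] at hx
    obtain ⟨p, rfl⟩ := hx
    exact ⟨p, Subtype.ext (Polynomial.aeval_subalgebra_coe p _ _)⟩
  · refine RingHom.ext fun p => ?_
    change ((Polynomial.aeval (⟨X, subset_adjoin rfl⟩ : adjoin K {(X : K⟦X⟧)}) p :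
      adjoin K {(X : K⟦X⟧)}) : K⟦X⟧) = (p : K⟦X⟧).map (algebraMap K K)
    rw [algebraMap_self, map_id, id_eq, Polynomial.aeval_subalgebra_coe]
    exact ((substAlgHom_coe HasSubst.X' p).symm.trans (by rw [coe_substAlgHom, X_subst]))

theorem isAlgebraic_of_subst_relations {K : Type*} [Field K] {e f g α β : K⟦X⟧}
    (he : IsAlgebraic (Polynomial K) e) (hf : IsAlgebraic (Polynomial K) f)
    (hα : constantCoeff α = 0) (hβ : constantCoeff β = 0)
    (hg : (1 - α - β) * g = 1)
    (heg : g * (1 - β) = e.subst (X * (1 - β)⁻¹ : K⟦X⟧))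
    (hfg : g * (1 - α) = f.subst (X * (1 - α)⁻¹ : K⟦X⟧)) :
    IsAlgebraic (Polynomial K) g := by
  have hu : (1 - β) * (1 - β)⁻¹ = 1 := PowerSeries.mul_inv_cancel _ (by simp [hβ])
  have hv : (1 - α) * (1 - α)⁻¹ = 1 := PowerSeries.mul_inv_cancel _ (by simp [hα])
  set u := (1 - β)⁻¹
  set v := (1 - α)⁻¹
  have hu0 : u ≠ 0 := right_ne_zero_of_mul_eq_one hu
  have hv0 : v ≠ 0 := right_ne_zero_of_mul_eq_one hv
  have hg0 : g ≠ 0 := right_ne_zero_of_mul_eq_one hg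
  have hX0 : (X : K⟦X⟧) ≠ 0 := X_ne_zero
  have self (x : K⟦X⟧) : IsAlgebraic (adjoin K {x}) x :=
    isAlgebraic_algebraMap (⟨x, subset_adjoin rfl⟩ : adjoin K {x})
  have hz : Transcendental K (X * g) :=
    transcendental_of_constantCoeff_eq_zero (mul_ne_zero hX0 hg0) (by simp)
  -- The relation reads `X * g = (X * w) * e(X * w)`; exchange turns it around.
  have key {e γ w : K⟦X⟧} (he : IsAlgebraic (Polynomial K) e) (hw : (1 - γ) * w = 1)
      (h : g * (1 - γ) = e.subst (X * w)) : IsAlgebraic (adjoin K {X * g}) (X * w) := by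
    refine IsAlgebraic.adjoin_singleton_symm ?_ hz
    have := (self (X * w)).mul (isAlgebraic_adjoin_subst he
      (mul_ne_zero hX0 (right_ne_zero_of_mul_eq_one hw)) (by simp))
    rw [← h] at this
    convert this using 1
    linear_combination (-X * g) * hw
  have hs := key he hu heg
  have hr := key hf hv hfg
  have hzz := self (X * g)
  -- This is `1/X = 1/s + 1/r - 1/z` with denominators cleared.
  have hrel : ((X * v) * (X * g) + (X * u) * (X * g) - (X * u) * (X * v)) * X =
      (X * u) * (X * v) * (X * g) := by
    linear_combination X ^ 3 * (u * v * hg - v * g * hu - u * g * hv)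
  have hne : (X * u) * (X * v) * (X * g) ≠ 0 := by positivity
  have hX : IsAlgebraic (adjoin K {X * g}) (X : K⟦X⟧) := by
    refine IsAlgebraic.of_mul (y := (X * v) * (X * g) + (X * u) * (X * g) - (X * u) * (X * v))
      (mem_nonZeroDivisors_of_ne_zero (left_ne_zero_of_mul (hrel ▸ hne)))
      (((hr.mul hzz).add (hs.mul hzz)).sub (hs.mul hr)) ?_
    rw [hrel]
    exact (hs.mul hr).mul hzz
  have hzX := hX.adjoin_singleton_symm (transcendental_of_constantCoeff_eq_zero hX0 (by simp))
  exact isAlgebraic_of_adjoin_X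
    (IsAlgebraic.of_mul (mem_nonZeroDivisors_of_ne_zero hX0) (self X) hzX)

end PowerSeries

end

/-! ### First return series as an `X`-adic fixed point -/

namespace PowerSeries

variable {K : Type*} [Field K]

theorem X_pow_dvd_inv_sub_inv {n : ℕ} {f g : K⟦X⟧} (h : X ^ n ∣ f - g) :
    X ^ n ∣ f⁻¹ - g⁻¹ := by
  rcases n.eq_zero_or_pos with rfl | hn
  · simp
  have hc : constantCoeff f = constantCoeff g := by
    have := X_dvd_iff.mp ((dvd_pow_self X hn.ne').trans h)
    rwa [map_sub, sub_eq_zero] at this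
  by_cases hf : constantCoeff f = 0
  · rw [inv_eq_zero.mpr hf, inv_eq_zero.mpr (hc ▸ hf)]
    simp
  · have h1 := PowerSeries.mul_inv_cancel f hf
    have h2 := PowerSeries.mul_inv_cancel g (hc ▸ hf)
    have : f⁻¹ - g⁻¹ = (f - g) * (-(f⁻¹ * g⁻¹)) := by
      linear_combination g⁻¹ * h1 - f⁻¹ * h2
    rw [this]
    exact h.mul_right _

theorem X_pow_dvd_subst_sub_subst {n : ℕ} {s r : K⟦X⟧} (f : K⟦X⟧) (hs : constantCoeff s = 0)
    (hr : constantCoeff r = 0) (h : X ^ n ∣ s - r) : X ^ n ∣ f.subst s - f.subst r := by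
  rw [X_pow_dvd_iff]
  intro m hm
  rw [map_sub, coeff_subst' (.of_constantCoeff_zero' hs), coeff_subst' (.of_constantCoeff_zero' hr),
    sub_eq_zero]
  refine finsum_congr fun d => ?_
  have := X_pow_dvd_iff.mp (h.trans (sub_dvd_pow_sub_pow s r d)) m hm
  rw [map_sub, sub_eq_zero] at this
  rw [this]

/-- A map that improves the agreement of power series by one coefficient has a fixed point. -/
theorem exists_fixedPoint_of_X_pow_dvd {R : Type*} [CommRing R] (Φ : R⟦X⟧ → R⟦X⟧)
    (hΦ : ∀ n f g, X ^ n ∣ f - g → X ^ (n + 1) ∣ Φ f - Φ g) : ∃ f, Φ f = f := by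
  have hstep (n : ℕ) : X ^ n ∣ Φ^[n + 1] 0 - Φ^[n] 0 := by
    induction n with
    | zero => simp
    | succ n ih =>
      rw [Function.iterate_succ_apply' Φ (n + 1)]
      nth_rewrite 2 [Function.iterate_succ_apply']
      exact hΦ _ _ _ ih
  have hle (n k : ℕ) : X ^ n ∣ Φ^[n + k] 0 - Φ^[n] 0 := by
    induction k with
    | zero => simp
    | succ k ih =>
      have := ((pow_dvd_pow X (Nat.le_add_right n k)).trans (hstep (n + k))).add ih
      simpa [add_assoc] using this
  -- Coefficient `n` of the iterates is stable from the iterate `n + 1` on.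
  let f : R⟦X⟧ := mk fun n => coeff n (Φ^[n + 1] 0)
  have hf (n : ℕ) : X ^ n ∣ f - Φ^[n] 0 := by
    rw [X_pow_dvd_iff]
    intro m hm
    obtain ⟨k, rfl⟩ := Nat.exists_eq_add_of_le (Nat.succ_le_of_lt hm)
    have := X_pow_dvd_iff.mp (hle (m + 1) k) m (Nat.lt_succ_self m)
    rw [map_sub, sub_eq_zero] at this ⊢
    rw [coeff_mk, ← this]
  refine ⟨f, ext fun n => ?_⟩
  have h1 := hΦ n _ _ (hf n)
  rw [← Function.iterate_succ_apply' Φ n] at h1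
  have := X_pow_dvd_iff.mp (h1.sub (hf (n + 1))) n (Nat.lt_succ_self n)
  rwa [sub_sub_sub_cancel_right, map_sub, sub_eq_zero] at this

/-- If `e` is a circuit series and `β` the series of first returns through branches attached at
every vertex, this is the series of first returns to the base point through its own copy. -/
noncomputable def branchReturn (e β : K⟦X⟧) : K⟦X⟧ :=
  (1 - β) * (1 - (e.subst (X * (1 - β)⁻¹ : K⟦X⟧))⁻¹)

theorem constantCoeff_subst_of_constantCoeff_eq_zero {s : K⟦X⟧} (hs : constantCoeff s = 0)
    (f : K⟦X⟧) : constantCoeff (f.subst s) = constantCoeff f := by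
  have h : constantCoeff ((f - C (constantCoeff f)).subst s) = 0 :=
    constantCoeff_subst_eq_zero hs _ (by simp)
  rw [subst_sub (.of_constantCoeff_zero' hs), subst_C] at h
  erw [map_sub, sub_eq_zero] at h
  rw [h]
  exact constantCoeff_C _

theorem constantCoeff_branchReturn {e : K⟦X⟧} (he : constantCoeff e = 1) (β : K⟦X⟧) :
    constantCoeff (branchReturn e β) = 0 := by
  simp [branchReturn, constantCoeff_subst_of_constantCoeff_eq_zero, he]

/-- The extra coefficient comes from the factor `X` in the substituted series and, for the prefactor
`1 - β`, from the vanishing constant term of the other factor. -/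
theorem X_pow_dvd_branchReturn_sub {e : K⟦X⟧} (he : constantCoeff e = 1) {n : ℕ} {β γ : K⟦X⟧}
    (h : X ^ n ∣ β - γ) : X ^ (n + 1) ∣ branchReturn e β - branchReturn e γ := by
  have h1 : X ^ (n + 1) ∣ X * (1 - β)⁻¹ - X * (1 - γ)⁻¹ := by
    rw [← mul_sub, pow_succ']
    refine mul_dvd_mul_left _ (X_pow_dvd_inv_sub_inv ?_)
    rw [sub_sub_sub_cancel_left, ← neg_sub]
    exact h.neg_right
  have h2 := X_pow_dvd_inv_sub_inv (X_pow_dvd_subst_sub_subst e (by simp) (by simp) h1)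
  have h3 : X ∣ 1 - (e.subst (X * (1 - γ)⁻¹ : K⟦X⟧))⁻¹ := by
    rw [X_dvd_iff]
    simp [constantCoeff_subst_of_constantCoeff_eq_zero, he]
  have h4 := mul_dvd_mul h h3
  rw [← pow_succ] at h4
  have := ((h2.mul_left (1 - β)).add h4).neg_right
  convert this using 1
  rw [branchReturn, branchReturn]
  ring

theorem exists_branchReturn_eq {e f : K⟦X⟧} (he : constantCoeff e = 1)
    (hf : constantCoeff f = 1) : ∃ α β : K⟦X⟧, branchReturn e β = α ∧ branchReturn f α = β := by
  obtain ⟨α, hα⟩ := exists_fixedPoint_of_X_pow_dvd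
    (fun α => branchReturn e (branchReturn f α)) fun n α γ h =>
      (pow_dvd_pow X (Nat.le_succ _)).trans
        (X_pow_dvd_branchReturn_sub he (X_pow_dvd_branchReturn_sub hf h))
  exact ⟨α, _, hα, rfl⟩

end PowerSeries

/-! ### Path series as solutions of linear systems -/

namespace InvGraph

variable {V : Type u} {E : Type v} {W : Type u'} {F : Type v'}

/-- The sum of `f` over the destinations of the edges that leave `x`. -/
noncomputable def sumNeighbors {M : Type*} [AddCommMonoid M] (G : InvGraph V E) (f : V → M)
    (x : V) : M :=
  ∑ᶠ e ∈ {e | G.src e = x}, f (G.dst e)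

theorem LocallyFinite.map_sumNeighbors {M N : Type*} [AddCommMonoid M] [AddCommMonoid N]
    {Φ : Type*} [FunLike Φ M N] [AddMonoidHomClass Φ M N] {G : InvGraph V E}
    (hG : G.LocallyFinite) (φ : Φ) (f : V → M) (x : V) :
    φ (G.sumNeighbors f x) = G.sumNeighbors (fun y => φ (f y)) x :=
  (φ : M →+ N).map_finsum_mem _ (hG x)

theorem pathsOfLength_zero (G : InvGraph V E) (x y : V) [Decidable (x = y)] :
    (G.pathsOfLength x y 0).ncard = if x = y then 1 else 0 := by
  have : G.pathsOfLength x y 0 = if x = y then {[]} else ∅ := by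
    ext l
    cases l <;> split_ifs <;> simp_all [pathsOfLength, IsPath]
  rw [this]
  split_ifs <;> simp

theorem LocallyFinite.pathsOfLength_succ {G : InvGraph V E} (hG : G.LocallyFinite) (x y : V)
    (n : ℕ) : (G.pathsOfLength x y (n + 1)).ncard =
      G.sumNeighbors (fun z => (G.pathsOfLength z y n).ncard) x := by
  have : G.pathsOfLength x y (n + 1) =
      ⋃ e ∈ {e | G.src e = x}, List.cons e '' G.pathsOfLength (G.dst e) y n := by
    ext l
    cases l <;> simp [pathsOfLength, IsPath, and_comm, and_assoc]
  rw [this, (hG x).ncard_biUnion, sumNeighbors]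
  · exact finsum_mem_congr rfl fun e _ => Set.ncard_image_of_injective _ List.cons_injective
  · exact fun e _ => (hG.finite_pathsOfLength _ _ _).image _
  · intro e _ e' _ hne
    rw [Function.onFun, Set.disjoint_left]
    rintro _ ⟨l, _, rfl⟩ ⟨l', _, h⟩
    exact hne (List.cons.inj h).1.symm

variable {R : Type*} [CommRing R]

open Classical in
theorem LocallyFinite.map_pathSeries_eq {G : InvGraph V E} (hG : G.LocallyFinite) (x y : V) :
    (G.pathSeries x y).map (Nat.castRingHom R) = (if x = y then 1 else 0) +
      X * G.sumNeighbors (fun z => (G.pathSeries z y).map (Nat.castRingHom R)) x := by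
  ext n
  cases n with
  | zero =>
    rw [map_add, coeff_zero_X_mul, coeff_map, pathSeries, coeff_mk, pathsOfLength_zero]
    split_ifs <;> simp
  | succ n =>
    have h := hG.map_sumNeighbors (Nat.castRingHom R) (fun z => (G.pathsOfLength z y n).ncard) x
    rw [map_add, coeff_succ_X_mul, hG.map_sumNeighbors]
    simp only [pathSeries, coeff_map, coeff_mk, hG.pathsOfLength_succ, h]
    split_ifs <;> simp [coeff_one]

open Classical in
/-- The path series to `y` are the only solution of the linear system that expresses a path as
its first edge followed by a shorter path. -/
theorem LocallyFinite.eq_map_pathSeries {G : InvGraph V E} (hG : G.LocallyFinite) {y : V}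
    {u : V → R⟦X⟧} (hu : ∀ x, u x = (if x = y then 1 else 0) + X * G.sumNeighbors u x) (x : V) :
    u x = (G.pathSeries x y).map (Nat.castRingHom R) := by
  ext n
  induction n generalizing x with
  | zero => rw [hu, hG.map_pathSeries_eq]; simp
  | succ n ih =>
    simp only [hu x, hG.map_pathSeries_eq x, map_add, coeff_succ_X_mul, hG.map_sumNeighbors, ih]

theorem constantCoeff_map_circuitSeries (G : InvGraph V E) (x : V) :
    constantCoeff ((G.circuitSeries x).map (Nat.castRingHom R)) = 1 := by
  classical
  rw [← coeff_zero_eq_constantCoeff_apply, coeff_map, circuitSeries, pathSeries, coeff_mk,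
    pathsOfLength_zero]
  simp

/-- The first passage series to the base point `a` when branches with first return series `β` are
attached at every vertex other than `a`. -/
theorem LocallyFinite.exists_firstPassage {K : Type*} [Field K] {A : InvGraph V E}
    (hA : A.LocallyFinite) (a : V) {β : K⟦X⟧} (hβ : constantCoeff β = 0) :
    ∃ h : V → K⟦X⟧, h a = 1 ∧ (∀ v ≠ a, X * A.sumNeighbors h v = (1 - β) * h v) ∧
      X * A.sumNeighbors h a =
        branchReturn ((A.circuitSeries a).map (Nat.castRingHom K)) β := by
  classical
  -- Each edge is preceded by any number of excursions into the branch at its source.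
  let s : K⟦X⟧ := X * (1 - β)⁻¹
  have hs : HasSubst s := .of_constantCoeff_zero' (by simp [s])
  let p (v : V) : K⟦X⟧ := ((A.pathSeries v a).map (Nat.castRingHom K)).subst s
  have hp (v : V) : p v = (if v = a then 1 else 0) + s * A.sumNeighbors p v := by
    have := congrArg (subst (R := K) s) (hA.map_pathSeries_eq (R := K) v a)
    simpa only [p, ← coe_substAlgHom hs, map_add, map_mul, substAlgHom_X,
      apply_ite (substAlgHom hs), map_one, map_zero, hA.map_sumNeighbors] using this
  have hpa : constantCoeff (p a) = 1 :=
    (constantCoeff_subst_of_constantCoeff_eq_zero (by simp [s]) _).trans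
      (constantCoeff_map_circuitSeries A a)
  have hcancel : (p a)⁻¹ * p a = 1 := PowerSeries.inv_mul_cancel _ (by simp [hpa])
  have hβ1 : (1 - β) * (1 - β)⁻¹ = 1 := PowerSeries.mul_inv_cancel _ (by simp [hβ])
  have hsum (v : V) : X * A.sumNeighbors (fun v => (p a)⁻¹ * p v) v =
      (1 - β) * (p a)⁻¹ * (p v - if v = a then 1 else 0) := by
    have h2 := hA.map_sumNeighbors (AddMonoidHom.mulLeft (p a)⁻¹) p v
    simp only [AddMonoidHom.coe_mulLeft] at h2
    rw [← h2, hp v]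
    linear_combination (-(p a)⁻¹ * X * A.sumNeighbors p v) * hβ1
  -- Cutting a path at its first visit to `a` gives `p v = h v * p a`.
  refine ⟨fun v => (p a)⁻¹ * p v, hcancel, fun v hv => ?_, ?_⟩
  · rw [hsum, if_neg hv]
    ring
  · rw [hsum, if_pos rfl]
    change _ = (1 - β) * (1 - (p a)⁻¹)
    linear_combination (1 - β) * hcancel

/-! ### Adjacency and weights in the free product -/

section

variable {a : V} {b : W}

/-- The head letter of a word tells its position in a copy. With `vertex_eq_vertex_iff`, this places
every vertex in exactly one copy of each graph. -/
theorem FPRootL.vertex_eq_iff_of_root (x w : FPRootL a b) (v : V) :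
    x.vertex v = w.1 ↔ x = w ∧ v = a := by
  by_cases hv : v = a
  · subst hv
    simp only [vertex_base, and_true]
    exact Subtype.ext_iff.symm
  · simp only [hv, and_false, iff_false]
    intro h
    have := w.2 (Sum.inl ⟨v, hv⟩) (by rw [← h, x.val_vertex_of_ne hv]; rfl)
    simp at this

theorem FPRootR.vertex_eq_iff_of_root (x w : FPRootR a b) (v : W) :
    x.vertex v = w.1 ↔ x = w ∧ v = b := by
  by_cases hv : v = b
  · subst hv
    simp only [vertex_base, and_true]
    exact Subtype.ext_iff.symm
  · simp only [hv, and_false, iff_false]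
    intro h
    have := w.2 (Sum.inr ⟨v, hv⟩) (by rw [← h, x.val_vertex_of_ne hv]; rfl)
    simp at this

theorem FPRootL.vertex_eq_vertex_iff (x w : FPRootL a b) {v v' : V} (hv' : v' ≠ a) :
    x.vertex v = w.vertex v' ↔ x = w ∧ v = v' := by
  refine ⟨fun h => ?_, by rintro ⟨rfl, rfl⟩; rfl⟩
  have hval := congrArg Subtype.val h
  rw [w.val_vertex_of_ne hv'] at hval
  by_cases hv : v = a
  · subst hv
    rw [vertex_base] at hval
    have := x.2 (Sum.inl ⟨v', hv'⟩) (by rw [hval]; rfl)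
    simp at this
  · rw [x.val_vertex_of_ne hv, List.cons.injEq, Sum.inl.injEq, Subtype.mk.injEq] at hval
    exact ⟨Subtype.ext (Subtype.ext hval.2), hval.1⟩

theorem FPRootR.vertex_eq_vertex_iff (x w : FPRootR a b) {v v' : W} (hv' : v' ≠ b) :
    x.vertex v = w.vertex v' ↔ x = w ∧ v = v' := by
  refine ⟨fun h => ?_, by rintro ⟨rfl, rfl⟩; rfl⟩
  have hval := congrArg Subtype.val h
  rw [w.val_vertex_of_ne hv'] at hval
  by_cases hv : v = b
  · subst hv
    rw [vertex_base] at hval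
    have := x.2 (Sum.inr ⟨v', hv'⟩) (by rw [hval]; rfl)
    simp at this
  · rw [x.val_vertex_of_ne hv, List.cons.injEq, Sum.inr.injEq, Subtype.mk.injEq] at hval
    exact ⟨Subtype.ext (Subtype.ext hval.2), hval.1⟩

/-- The base is a base point of copies of both graphs; any other vertex is a vertex apart from the
base point in a copy of one graph, and the base point of a copy of the other. -/
theorem FPVertex.cases_vertex (x : FPVertex a b) :
    (x = base a b ∧ (∃ w : FPRootL a b, w.1 = x) ∧ ∃ w : FPRootR a b, w.1 = x) ∨
    (x ≠ base a b ∧ (∃ w : FPRootR a b, w.1 = x) ∧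
      ∃ w : FPRootL a b, ∃ v ≠ a, w.vertex v = x) ∨
    (x ≠ base a b ∧ (∃ w : FPRootL a b, w.1 = x) ∧
      ∃ w : FPRootR a b, ∃ v ≠ b, w.vertex v = x) := by
  obtain ⟨l, hl⟩ := x
  match l, hl with
  | [], hl =>
    exact .inl ⟨rfl, ⟨⟨⟨[], hl⟩, by simp⟩, rfl⟩, ⟨⟨[], hl⟩, by simp⟩, rfl⟩
  | .inl v :: l, hl =>
    have hc := List.isChain_cons.mp hl
    refine .inr (.inl ⟨fun h => by simpa [base] using congrArg Subtype.val h,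
      ⟨⟨⟨_, hl⟩, by simp⟩, rfl⟩, ⟨⟨l, hc.2⟩, fun y hy => ?_⟩, v.1, v.2, Subtype.ext ?_⟩)
    · simpa using hc.1 y hy
    · exact FPRootL.val_vertex_of_ne _ v.2
  | .inr v :: l, hl =>
    have hc := List.isChain_cons.mp hl
    refine .inr (.inr ⟨fun h => by simpa [base] using congrArg Subtype.val h,
      ⟨⟨⟨_, hl⟩, by simp⟩, rfl⟩, ⟨⟨l, hc.2⟩, fun y hy => ?_⟩, v.1, v.2, Subtype.ext ?_⟩)
    · simpa using hc.1 y hy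
    · exact FPRootR.val_vertex_of_ne _ v.2

end

/-- The neighbours of a vertex of the free product in its copies of the two graphs. -/
theorem LocallyFinite.sumNeighbors_freeProduct {M : Type*} [AddCommMonoid M] {A : InvGraph V E}
    {B : InvGraph W F} (hA : A.LocallyFinite) (hB : B.LocallyFinite) {a : V} {b : W}
    {x : FPVertex a b} {p : FPRootL a b} {v : V} {q : FPRootR a b} {w : W}
    (hp : ∀ p' v', FPRootL.vertex p' v' = x ↔ p' = p ∧ v' = v)
    (hq : ∀ q' w', FPRootR.vertex q' w' = x ↔ q' = q ∧ w' = w) (f : FPVertex a b → M) :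
    (A.freeProduct a B b).sumNeighbors f x =
      A.sumNeighbors (fun v => f (p.vertex v)) v + B.sumNeighbors (fun w => f (q.vertex w)) w := by
  have hset : {e | (A.freeProduct a B b).src e = x} =
      (fun e => .inl (p, e)) '' {e | A.src e = v} ∪ (fun e => .inr (q, e)) '' {e | B.src e = w} := by
    ext e
    rcases e with ⟨p', e⟩ | ⟨q', e⟩
    · refine (hp p' (A.src e)).trans ?_
      simp [and_comm, eq_comm]
    · refine (hq q' (B.src e)).trans ?_
      simp [and_comm, eq_comm]
  rw [sumNeighbors, hset, finsum_mem_union _ ((hA v).image _) ((hB w).image _),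
    finsum_mem_image, finsum_mem_image]
  · rfl
  · intro e _ e' _ h
    simpa using h
  · intro e _ e' _ h
    simpa using h
  · rw [Set.disjoint_left]
    rintro _ ⟨e, _, rfl⟩ ⟨e', _, h⟩
    simp at h

section

variable {R : Type*} [CommRing R] {a : V} {b : W}

/-- The product of weights of the letters of a vertex of the free product. -/
noncomputable def FPVertex.weight (h : V → R) (k : W → R) (x : FPVertex a b) : R :=
  (x.1.map (Sum.elim (fun v => h v.1) fun w => k w.1)).prod

theorem FPRootL.weight_vertex {h : V → R} (k : W → R) (ha : h a = 1) (p : FPRootL a b) (v : V) :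
    (p.vertex v).weight h k = p.1.weight h k * h v := by
  by_cases hv : v = a
  · rw [hv, vertex_base, ha, mul_one]
  · simp [FPVertex.weight, p.val_vertex_of_ne hv, mul_comm]

theorem FPRootR.weight_vertex (h : V → R) {k : W → R} (hb : k b = 1) (q : FPRootR a b) (w : W) :
    (q.vertex w).weight h k = q.1.weight h k * k w := by
  by_cases hw : w = b
  · rw [hw, vertex_base, hb, mul_one]
  · simp [FPVertex.weight, q.val_vertex_of_ne hw, mul_comm]

end

/-- A path to the base removes the letters of its starting word one by one, head first, each by a
first passage, and ends with a circuit. This suggests the solution `(1 - α - β)⁻¹ * x.weight h k`.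
-/
theorem LocallyFinite.circuitSeries_freeProduct {K : Type*} [Field K] {A : InvGraph V E}
    {B : InvGraph W F} (hA : A.LocallyFinite) (hB : B.LocallyFinite) (a : V) (b : W)
    {α β : K⟦X⟧} (hα : branchReturn ((A.circuitSeries a).map (Nat.castRingHom K)) β = α)
    (hβ : branchReturn ((B.circuitSeries b).map (Nat.castRingHom K)) α = β) :
    (1 - α - β) * ((A.freeProduct a B b).circuitSeries (FPVertex.base a b)).map
      (Nat.castRingHom K) = 1 := by
  classical
  have hα0 : constantCoeff α = 0 :=
    hα ▸ constantCoeff_branchReturn (A.constantCoeff_map_circuitSeries a) β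
  have hβ0 : constantCoeff β = 0 :=
    hβ ▸ constantCoeff_branchReturn (B.constantCoeff_map_circuitSeries b) α
  obtain ⟨h, ha, hne, hsum⟩ := hA.exists_firstPassage a hβ0
  obtain ⟨k, hb, kne, ksum⟩ := hB.exists_firstPassage b hα0
  rw [hα] at hsum
  rw [hβ] at ksum
  have hinv : (1 - α - β) * (1 - α - β)⁻¹ = 1 :=
    PowerSeries.mul_inv_cancel _ (by simp [hα0, hβ0])
  have hL (c : K⟦X⟧) (v : V) : A.sumNeighbors (fun v => c * h v) v = c * A.sumNeighbors h v :=
    (hA.map_sumNeighbors (AddMonoidHom.mulLeft c) h v).symm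
  have hR (c : K⟦X⟧) (w : W) : B.sumNeighbors (fun w => c * k w) w = c * B.sumNeighbors k w :=
    (hB.map_sumNeighbors (AddMonoidHom.mulLeft c) k w).symm
  have key := (hA.freeProduct hB a b).eq_map_pathSeries (R := K) (y := FPVertex.base a b)
    (u := fun x => (1 - α - β)⁻¹ * x.weight h k) ?_ (FPVertex.base a b)
  · rw [circuitSeries, ← key]
    simpa [FPVertex.weight, FPVertex.base] using hinv
  intro x
  rcases x.cases_vertex with ⟨hx, ⟨p, hp⟩, q, hq⟩ | ⟨hx, ⟨q, hq⟩, p, v, hv, hp⟩ |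
    ⟨hx, ⟨p, hp⟩, q, w, hw, hq⟩
  · have hwt : x.weight h k = 1 := by simp [hx, FPVertex.weight, FPVertex.base]
    rw [if_pos hx, hA.sumNeighbors_freeProduct hB (x := x)
      (fun p' v' => hp ▸ p'.vertex_eq_iff_of_root p v')
      (fun q' w' => hq ▸ q'.vertex_eq_iff_of_root q w')]
    simp only [p.weight_vertex k ha, q.weight_vertex h hb, hp, hq, ← mul_assoc, hL, hR, hwt]
    linear_combination hinv - (1 - α - β)⁻¹ * (hsum + ksum)
  -- After multiplication by `X`, the neighbours in the copy of `A` contribute `1 - β` times the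
  -- value at `x`, those in the copy of `B` rooted at `x` contribute `β` times it.
  · have hwt := p.weight_vertex k ha v
    rw [hp] at hwt
    rw [if_neg hx, hA.sumNeighbors_freeProduct hB (x := x)
      (fun p' v' => hp ▸ p'.vertex_eq_vertex_iff p hv)
      (fun q' w' => hq ▸ q'.vertex_eq_iff_of_root q w')]
    simp only [p.weight_vertex k ha, q.weight_vertex h hb, hq, ← mul_assoc, hL, hR, hwt]
    linear_combination -(1 - α - β)⁻¹ * p.1.weight h k * (hne v hv + h v * ksum)
  · have hwt := q.weight_vertex h hb w
    rw [hq] at hwt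
    rw [if_neg hx, hA.sumNeighbors_freeProduct hB (x := x)
      (fun p' v' => hp ▸ p'.vertex_eq_iff_of_root p v')
      (fun q' w' => hq ▸ q'.vertex_eq_vertex_iff q hw)]
    simp only [p.weight_vertex k ha, q.weight_vertex h hb, hp, ← mul_assoc, hL, hR, hwt]
    linear_combination -(1 - α - β)⁻¹ * q.1.weight h k * (kne w hw + k w * hsum)

end InvGraph

/-- Unfolding `branchReturn` gives `1 - α - β = (1 - β) / e(s)` with `s = X / (1 - β)`. -/
theorem PowerSeries.mul_one_sub_eq_subst_of_branchReturn {K : Type*} [Field K] {e g α β : K⟦X⟧}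
    (he : constantCoeff e = 1) (hα : branchReturn e β = α) (hg : (1 - α - β) * g = 1) :
    g * (1 - β) = e.subst (X * (1 - β)⁻¹ : K⟦X⟧) := by
  have hinv := PowerSeries.mul_inv_cancel (e.subst (X * (1 - β)⁻¹ : K⟦X⟧))
    (by rw [constantCoeff_subst_of_constantCoeff_eq_zero (by simp), he]; exact one_ne_zero)
  rw [branchReturn] at hα
  linear_combination (e.subst (X * (1 - β)⁻¹ : K⟦X⟧)) * (hg - g * hα) - g * (1 - β) * hinv

theorem mainTheorem12 {V : Type*} {E : Type*} {W : Type*} {F : Type*}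
    (A : InvGraph V E) (a : V) (B : InvGraph W F) (b : W)
    (hA : A.LocallyFinite) (hB : B.LocallyFinite)
    (hAc : A.Connected) (hBc : B.Connected)
    (hAalg : IsAlgebraicSeries (A.circuitSeries a))
    (hBalg : IsAlgebraicSeries (B.circuitSeries b)) :
    IsAlgebraicSeries ((A.freeProduct a B b).circuitSeries (InvGraph.FPVertex.base a b)) := by
  have he := A.constantCoeff_map_circuitSeries (R := ℚ) a
  have hf := B.constantCoeff_map_circuitSeries (R := ℚ) b
  obtain ⟨α, β, hα, hβ⟩ := exists_branchReturn_eq he hf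
  have hg := hA.circuitSeries_freeProduct hB a b hα hβ
  exact isAlgebraic_of_subst_relations hAalg hBalg
    (hα ▸ constantCoeff_branchReturn he β) (hβ ▸ constantCoeff_branchReturn hf α) hg
    (mul_one_sub_eq_subst_of_branchReturn he hα hg)
    (mul_one_sub_eq_subst_of_branchReturn hf hβ (by rwa [sub_right_comm]))
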